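/- Let $n\ge 1$. Cubes are cubes in $\mathbb{R}^n$ with sides parallel to the coordinate axes and positive side length. A weight is a locally integrable function $w:\mathbb{R}^n\to\mathbb{R}$ with $w>0$ almost everywhere; write $w(Q)=\int_Q w\,dx$. For $1<p<\infty$ put $$[w]_{A_p}=\sup_Q\Big(\frac1{|Q|}\int_Q w\Big)\Big(\frac1{|Q|}\int_Q w^{1-p'}\Big)^{p-1},\quad p'=\frac{p}{p-1},\qquad [w]_{A_1}=\sup_Q\Big(\frac1{|Q|}\int_Q w\Big)\operatorname*{ess\,sup}_Q w^{-1},$$ let $A_p$ be the class of weights with $[w]_{A_p}<\infty$, and $A_\infty=\bigcup_{p\ge 1}A_p$. Let $$[w]'_{A_\infty}=\sup_Q\Big(\frac1{|Q|}\int_Q w\Big)\exp\Big(\frac1{|Q|}\int_Q\log w^{-1}\Big),\qquad [w]_{A_\infty}=\sup_Q\frac1{w(Q)}\int_Q M(w\chi_Q)\,dx$$ be the Hruščev and the Fujii–Wilson constant, where $Mf(x)=\sup_{Q\ni x}\frac1{|Q|}\int_Q|f|$ is the Hardy–Littlewood maximal function. For $f\in L^1_{\mathrm{loc}}(\mathbb{R}^n)$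 let $\|f\|_{\mathrm{BMO}}=\sup_Q\frac1{|Q|}\int_Q|f-f_Q|\,dx$ with $f_Q=\frac1{|Q|}\int_Q f$, and let $\mathrm{BMO}$ be the set of such $f$ with $\|f\|_{\mathrm{BMO}}<\infty$. All suprema are over all cubes $Q$. Theorem. There is a constant $c_n>0$, depending only on $n$, such that for every $w\in A_\infty$ the constants $[w]_{A_\infty}$ and $[w]'_{A_\infty}$ are finite, $\log w\in\mathrm{BMO}$, and $$\|\log w\|_{\mathrm{BMO}}\le c_n\,\log\big(2[w]'_{A_\infty}\big)\,\big([w]_{A_\infty}-1\big).$$ -/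

import Mathlib

open MeasureTheory
open scoped ENNReal

noncomputable section

namespace Weights

/-- A (closed) cube of `ℝⁿ` with sides parallel to the coordinate axes and side length `ℓ > 0`. -/
def IsCube {n : ℕ} (Q : Set (Fin n → ℝ)) : Prop :=
  ∃ (a : Fin n → ℝ) (ℓ : ℝ), 0 < ℓ ∧ Q = Set.Icc a (fun i => a i + ℓ)

/-- A weight: a locally integrable function that is positive almost everywhere. -/
structure IsWeight {n : ℕ} (w : (Fin n → ℝ) → ℝ) : Prop where
  locallyIntegrable : LocallyIntegrable w volume
  ae_pos : ∀ᵐ x, 0 < w x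

/-- The Muckenhoupt constant `[w]_{A_p}`, `1 ≤ p < ∞`, with values in `[0, ∞]`. In the case `p > 1`
the exponent `1 - p / (p - 1)` is `1 - p'`. -/
def ApConst {n : ℕ} (p : ℝ) (w : (Fin n → ℝ) → ℝ) : ℝ≥0∞ :=
  if p = 1 then
    ⨆ (Q : Set (Fin n → ℝ)) (_ : IsCube Q),
      (⨍⁻ y in Q, ENNReal.ofReal (w y) ∂volume) *
        essSup (fun y => (ENNReal.ofReal (w y))⁻¹) (volume.restrict Q)
  else
    ⨆ (Q : Set (Fin n → ℝ)) (_ : IsCube Q),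
      (⨍⁻ y in Q, ENNReal.ofReal (w y) ∂volume) *
        (⨍⁻ y in Q, ENNReal.ofReal (w y) ^ (1 - p / (p - 1)) ∂volume) ^ (p - 1)

/-- The class `A_p`, `1 ≤ p < ∞`. -/
def MemAp {n : ℕ} (p : ℝ) (w : (Fin n → ℝ) → ℝ) : Prop :=
  IsWeight w ∧ ApConst p w < ∞

/-- The class `A_∞`, the union of the classes `A_p` over `p ≥ 1`. -/
def MemAinfty {n : ℕ} (w : (Fin n → ℝ) → ℝ) : Prop :=
  ∃ p : ℝ, 1 ≤ p ∧ MemAp p w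

/-- The (uncentered, cubic) Hardy--Littlewood maximal function. -/
def maximalFunction {n : ℕ} (f : (Fin n → ℝ) → ℝ) (x : Fin n → ℝ) : ℝ≥0∞ :=
  ⨆ (Q : Set (Fin n → ℝ)) (_ : IsCube Q) (_ : x ∈ Q), ⨍⁻ y in Q, ‖f y‖ₑ ∂volume

/-- The Fujii--Wilson constant `[w]_{A_∞}`. -/
def fujiiWilsonConst {n : ℕ} (w : (Fin n → ℝ) → ℝ) : ℝ≥0∞ :=
  ⨆ (Q : Set (Fin n → ℝ)) (_ : IsCube Q),
    (∫⁻ x in Q, maximalFunction (Q.indicator w) x) / ∫⁻ x in Q, ENNReal.ofReal (w x)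

open Classical in
/-- The geometric factor `exp (⨍_Q log w⁻¹)`. For a weight `w` the positive part of `log w` is
integrable on cubes, so if `log w` is not integrable on `Q` then the average of `log w⁻¹` over `Q`
is `+∞`, and so is its exponential. -/
def expAvgLogInv {n : ℕ} (w : (Fin n → ℝ) → ℝ) (Q : Set (Fin n → ℝ)) : ℝ≥0∞ :=
  if IntegrableOn (fun x => Real.log (w x)⁻¹) Q volume then
    ENNReal.ofReal (Real.exp (⨍ x in Q, Real.log (w x)⁻¹ ∂volume))
  else ∞

/-- The Hruščev constant `[w]'_{A_∞}`. -/
def hruscevConst {n : ℕ} (w : (Fin n → ℝ) → ℝ) : ℝ≥0∞ :=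
  ⨆ (Q : Set (Fin n → ℝ)) (_ : IsCube Q),
    (⨍⁻ x in Q, ENNReal.ofReal (w x) ∂volume) * expAvgLogInv w Q

/-- The `BMO` seminorm (of a locally integrable function), with values in `[0, ∞]`. -/
def bmoSeminorm {n : ℕ} (f : (Fin n → ℝ) → ℝ) : ℝ≥0∞ :=
  ⨆ (Q : Set (Fin n → ℝ)) (_ : IsCube Q), ⨍⁻ x in Q, ‖f x - ⨍ y in Q, f y ∂volume‖ₑ ∂volume

/-- The space `BMO`. -/
def MemBMO {n : ℕ} (f : (Fin n → ℝ) → ℝ) : Prop :=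
  LocallyIntegrable f volume ∧ bmoSeminorm f < ∞

end Weights

end

/-!
Write `δ = [w]_{A_∞} - 1`, `L = log (2 [w]'_{A_∞})` and `w_Q` for the mean of `w` over `Q`. Cubes are
the closed balls of the sup norm, so Vitali's covering lemma and the Lebesgue density theorem apply
to them directly and no dyadic decomposition is needed.

*Finiteness.* A weight in `A_p` satisfies `(w_Q) ^ q * (w ^ (-q))_Q ≤ D` for some `q > 0`
(`MemAinfty.exists_power_condition`). Jensen's inequality turns this into the finiteness of
`[w]'_{A_∞}`. By Markov's inequality it also shows that `w > c t` on half of every cube with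
`w_R > t`; Vitali's lemma then gives
`|{x ∈ Q : M (w χ_Q) > t}| ≤ 2 * 5 ^ n * |{x ∈ Q : w > c t}|`, and integrating in `t` bounds
`[w]_{A_∞}`.

*Large `δ`.* Since `(log (w / w_Q))⁺ ≤ w / w_Q` and the mean of `log (w_Q / w)` is at most
`log [w]'_{A_∞}`, the function `log w` oscillates by at most a multiple of `L` on every cube
(`MemAinfty.integral_abs_log_sub_le`). This is enough when `δ` is bounded below.

*Small `δ`.* On `Q` one has `M (w χ_Q) ≥ max w w_Q` almost everywhere, hence
`∫_Q (w_Q - w)⁺ ≤ δ w(Q)` (`MemAinfty.integral_max_sub_le`). Let `P` be the double of `Q` and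
`A = w_P`. Where `w ≥ A / 2`, the distance from `log w` to `log A` is at most `2 |w - A| / A`, whose
mean over `P` is at most a multiple of `δ`. The remaining set `F = {w < A / 2} ∩ P` has volume at most
`2 δ |P|`. The part of it in `Q` is covered by balls in `P` of total volume at most a multiple of
`|F|` in which `F` has density at most one half (`exists_stopping_balls`). The mean of `w` over such
a ball is at least `A / 4`, so that the bound by `L` on this ball also holds for the distance from
`log w` to `log A` on `F`. Summing gives a contribution of order `δ L |Q|`
(`MemAinfty.lintegral_abs_log_sub_le_of_small`).
-/

namespace Weights

open Metric Set Filter Topology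

/-! ### Cubes as balls of the sup norm -/

lemma closedBall_eq_Icc_add {n : ℕ} (c : Fin n → ℝ) {r : ℝ} (hr : 0 ≤ r) :
    closedBall c r = Icc (fun i => c i - r) (fun i => c i - r + 2 * r) := by
  ext y
  rw [closedBall_pi c hr]
  simp only [Set.mem_pi, mem_univ, true_imp_iff, Real.closedBall_eq_Icc, mem_Icc, Pi.le_def]
  rw [← forall_and]
  refine forall_congr' fun i => ?_
  constructor <;> rintro ⟨h1, h2⟩ <;> constructor <;> linarith

lemma isCube_closedBall {n : ℕ} (c : Fin n → ℝ) {r : ℝ} (hr : 0 < r) : IsCube (closedBall c r) :=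
  ⟨fun i => c i - r, 2 * r, by positivity, closedBall_eq_Icc_add c hr.le⟩

lemma IsCube.exists_eq_closedBall {n : ℕ} {Q : Set (Fin n → ℝ)} (hQ : IsCube Q) :
    ∃ c r, 0 < r ∧ Q = closedBall c r := by
  obtain ⟨a, ℓ, hℓ, rfl⟩ := hQ
  refine ⟨fun i => a i + ℓ / 2, ℓ / 2, by positivity, ?_⟩
  rw [closedBall_eq_Icc_add _ (by positivity)]
  congr 1 <;> (ext i; simp; try ring)

lemma IsCube.isCompact {n : ℕ} {Q : Set (Fin n → ℝ)} (hQ : IsCube Q) : IsCompact Q := by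
  obtain ⟨a, ℓ, -, rfl⟩ := hQ
  exact isCompact_Icc

lemma IsCube.measurableSet {n : ℕ} {Q : Set (Fin n → ℝ)} (hQ : IsCube Q) : MeasurableSet Q :=
  hQ.isCompact.isClosed.measurableSet

lemma IsCube.volume_ne_top {n : ℕ} {Q : Set (Fin n → ℝ)} (hQ : IsCube Q) : volume Q ≠ ∞ :=
  hQ.isCompact.measure_lt_top.ne

lemma IsCube.volume_ne_zero {n : ℕ} {Q : Set (Fin n → ℝ)} (hQ : IsCube Q) : volume Q ≠ 0 := by
  obtain ⟨c, r, hr, rfl⟩ := hQ.exists_eq_closedBall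
  exact (measure_closedBall_pos volume c hr).ne'

lemma volume_closedBall_mul {n : ℕ} (c c' : Fin n → ℝ) {k r : ℝ} (hk : 0 ≤ k) (hr : 0 ≤ r) :
    volume (closedBall c (k * r)) = ENNReal.ofReal k ^ n * volume (closedBall c' r) := by
  rw [Real.volume_pi_closedBall _ (by positivity), Real.volume_pi_closedBall _ hr,
    ← ENNReal.ofReal_pow hk, ← ENNReal.ofReal_mul (by positivity)]
  congr 1
  simp only [Fintype.card_fin]
  rw [← mul_pow]
  ring_nf

/-- A cube `R` can be translated, and shrunk to the size of `Q` if it is larger, so as to lie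
inside `Q` without losing any point of `R ∩ Q`. -/
lemma IsCube.exists_subset_cube {n : ℕ} {Q R : Set (Fin n → ℝ)} (hQ : IsCube Q) (hR : IsCube R) :
    ∃ R', IsCube R' ∧ R' ⊆ Q ∧ R ∩ Q ⊆ R' ∧ volume R' ≤ volume R := by
  obtain ⟨b, L, hL, rfl⟩ := hQ
  obtain ⟨a, ℓ, hℓ, rfl⟩ := hR
  refine ⟨Icc (fun i => max (b i) (min (a i) (b i + L - min ℓ L)))
    (fun i => max (b i) (min (a i) (b i + L - min ℓ L)) + min ℓ L),
    ⟨_, _, lt_min hℓ hL, rfl⟩, ?_, ?_, ?_⟩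
  · refine Icc_subset_Icc (fun i => le_max_left _ _) fun i => ?_
    have : max (b i) (min (a i) (b i + L - min ℓ L)) ≤ b i + L - min ℓ L :=
      max_le (by linarith [min_le_right ℓ L]) (min_le_right _ _)
    dsimp only
    linarith
  · rintro y ⟨⟨h1, h2⟩, h3, h4⟩
    refine ⟨fun i => max_le (h3 i) ((min_le_left _ _).trans (h1 i)), fun i => ?_⟩
    have h2 := h2 i
    have h4 := h4 i
    dsimp only at h2 h4 ⊢
    rcases le_total ℓ L with h | h
    · rw [min_eq_left h]
      rcases le_total (a i) (b i + L - ℓ) with h' | h'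
      · rw [min_eq_left h']
        linarith [le_max_right (b i) (a i)]
      · rw [min_eq_right h']
        linarith [le_max_right (b i) (b i + L - ℓ)]
    · rw [min_eq_right h]
      linarith [le_max_left (b i) (min (a i) (b i + L - L))]
  · rw [Real.volume_Icc_pi, Real.volume_Icc_pi]
    refine Finset.prod_le_prod' fun i _ => ENNReal.ofReal_le_ofReal ?_
    simp

/-! ### Covering and layer-cake estimates -/

/-- **Vitali covering** in the form used below: a set covered by balls of bounded radius, each of
which meets `F` in at least half of its volume, is covered by countably many five times larger
balls whose total volume is controlled by that of `F`. -/
lemma exists_countable_covering {n : ℕ} {S F : Set (Fin n → ℝ)} {T : Set ((Fin n → ℝ) × ℝ)} {R : ℝ}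
    (hT : ∀ B ∈ T, 0 < B.2 ∧ B.2 ≤ R) (hS : ∀ x ∈ S, ∃ B ∈ T, x ∈ closedBall B.1 B.2)
    (hF : ∀ B ∈ T, volume (closedBall B.1 B.2) ≤ 2 * volume (F ∩ closedBall B.1 B.2)) :
    ∃ u ⊆ T, u.Countable ∧ S ⊆ ⋃ B ∈ u, closedBall B.1 (5 * B.2) ∧
      ∑' B : u, volume (closedBall B.1.1 (5 * B.1.2)) ≤ 2 * 5 ^ n * volume F := by
  obtain ⟨u, huT, hdisj, hcov⟩ := Vitali.exists_disjoint_subfamily_covering_enlargement_closedBall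
    T (fun B => B.1) (fun B => B.2) R (fun B hB => (hT B hB).2) 5 (by norm_num)
  have hcount : u.Countable := by
    refine hdisj.countable_of_nonempty_interior fun B hB => ?_
    exact ((nonempty_ball.2 (hT B (huT hB)).1).mono ball_subset_interior_closedBall)
  refine ⟨u, huT, hcount, fun x hx => ?_, ?_⟩
  · obtain ⟨B, hB, hxB⟩ := hS x hx
    obtain ⟨B', hB', hsub⟩ := hcov B hB
    exact mem_biUnion hB' (hsub hxB)
  · have : Countable u := hcount.to_subtype
    calc ∑' B : u, volume (closedBall B.1.1 (5 * B.1.2))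
        ≤ ∑' B : u, 2 * 5 ^ n * volume.restrict F (closedBall B.1.1 B.1.2) := by
          refine ENNReal.tsum_le_tsum fun B => ?_
          rw [volume_closedBall_mul B.1.1 B.1.1 (by norm_num) (hT B (huT B.2)).1.le,
            Measure.restrict_apply isClosed_closedBall.measurableSet, inter_comm _ F,
            mul_comm 2, mul_assoc]
          have := hF B (huT B.2)
          norm_num
          gcongr
      _ = 2 * 5 ^ n * volume.restrict F (⋃ B : u, closedBall B.1.1 B.1.2) := by
          rw [ENNReal.tsum_mul_left, measure_iUnion]
          · intro B B' h
            exact hdisj B.2 B'.2 (fun h' => h (Subtype.ext h'))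
          · exact fun B => isClosed_closedBall.measurableSet
      _ ≤ 2 * 5 ^ n * volume F := by
          gcongr 2 * 5 ^ n * ?_
          exact (measure_mono (subset_univ _)).trans (Measure.restrict_apply_univ F).le

/-- The layer-cake formula for functions with values in `[0, ∞]`. -/
lemma lintegral_eq_lintegral_meas_ofReal_lt {α : Type*} [MeasurableSpace α] (μ : Measure α)
    [SFinite μ] {f : α → ℝ≥0∞} (hf : AEMeasurable f μ) :
    ∫⁻ x, f x ∂μ = ∫⁻ t in Ioi (0 : ℝ), μ {x | ENNReal.ofReal t < f x} := by
  wlog h : Measurable f generalizing f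
  · rw [lintegral_congr_ae hf.ae_eq_mk, this hf.measurable_mk.aemeasurable hf.measurable_mk]
    refine lintegral_congr fun t => measure_congr ?_
    filter_upwards [hf.ae_eq_mk] with x hx
    exact congrArg (fun z => ENNReal.ofReal t < z) hx.symm
  have hset : MeasurableSet {z : α × ℝ | ENNReal.ofReal z.2 < f z.1} :=
    measurableSet_lt (by fun_prop) (by fun_prop)
  have key (a : ℝ≥0∞) : a = ∫⁻ t in Ioi (0 : ℝ), {t | ENNReal.ofReal t < a}.indicator 1 t := by
    rw [lintegral_indicator_one (measurableSet_lt (by fun_prop) (by fun_prop)),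
      Measure.restrict_apply (measurableSet_lt (by fun_prop) (by fun_prop))]
    rcases eq_or_ne a ∞ with rfl | ha
    · simp
    · have : {t | ENNReal.ofReal t < a} ∩ Ioi 0 = Ioo 0 a.toReal := by
        ext t
        constructor
        · rintro ⟨h1, h2⟩
          exact ⟨h2, (ENNReal.ofReal_lt_iff_lt_toReal (le_of_lt h2) ha).1 h1⟩
        · rintro ⟨h1, h2⟩
          exact ⟨(ENNReal.ofReal_lt_iff_lt_toReal h1.le ha).2 h2, h1⟩
      rw [this, Real.volume_Ioo, sub_zero, ENNReal.ofReal_toReal ha]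
  calc ∫⁻ x, f x ∂μ
      = ∫⁻ x, (∫⁻ t in Ioi (0 : ℝ),
          {z : α × ℝ | ENNReal.ofReal z.2 < f z.1}.indicator 1 (x, t)) ∂μ :=
        lintegral_congr fun x => key (f x)
    _ = ∫⁻ t in Ioi (0 : ℝ),
          ∫⁻ x, {z : α × ℝ | ENNReal.ofReal z.2 < f z.1}.indicator 1 (x, t) ∂μ :=
        lintegral_lintegral_swap ((measurable_one.indicator hset).aemeasurable)
    _ = ∫⁻ t in Ioi (0 : ℝ), μ {x | ENNReal.ofReal t < f x} := by
        refine lintegral_congr fun t => ?_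
        rw [← lintegral_indicator_one (measurableSet_lt (by fun_prop) h)]
        rfl

/-- A bound between distribution functions passes to the integrals, the larger of the two
functions not being assumed measurable. -/
lemma lintegral_le_of_meas_lt_le {α : Type*} [MeasurableSpace α] (μ : Measure α) [SFinite μ]
    {f g : α → ℝ≥0∞} (hg : AEMeasurable g μ) {C : ℝ≥0∞} (hC : C ≠ ∞)
    (h : ∀ t : ℝ, 0 < t → μ {x | ENNReal.ofReal t < f x} ≤ C * μ {x | ENNReal.ofReal t < g x}) :
    ∫⁻ x, f x ∂μ ≤ C * ∫⁻ x, g x ∂μ := by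
  obtain ⟨f', hf'm, hf'le, hf'⟩ := exists_measurable_le_lintegral_eq μ f
  rw [hf', lintegral_eq_lintegral_meas_ofReal_lt μ hf'm.aemeasurable,
    lintegral_eq_lintegral_meas_ofReal_lt μ hg, ← lintegral_const_mul' _ _ hC]
  refine setLIntegral_mono' measurableSet_Ioi fun t ht => le_trans (measure_mono ?_) (h t ht)
  exact fun x hx => lt_of_lt_of_le hx (hf'le x)

/-! ### The power condition satisfied by `A_∞` weights -/

lemma IsWeight.integrableOn {n : ℕ} {w : (Fin n → ℝ) → ℝ} (hw : IsWeight w) {Q : Set (Fin n → ℝ)}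
    (hQ : IsCube Q) : IntegrableOn w Q :=
  hw.locallyIntegrable.integrableOn_isCompact hQ.isCompact

lemma IsWeight.aemeasurable {n : ℕ} {w : (Fin n → ℝ) → ℝ} (hw : IsWeight w) : AEMeasurable w :=
  hw.locallyIntegrable.aestronglyMeasurable.aemeasurable

lemma IsWeight.laverage_eq {n : ℕ} {w : (Fin n → ℝ) → ℝ} (hw : IsWeight w)
    {Q : Set (Fin n → ℝ)} (hQ : IsCube Q) :
    ⨍⁻ x in Q, ENNReal.ofReal (w x) ∂volume = ENNReal.ofReal (⨍ x in Q, w x ∂volume) := by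
  rw [ofReal_setAverage (hw.integrableOn hQ), setLAverage_eq]
  exact ae_restrict_of_ae (hw.ae_pos.mono fun x hx => hx.le)

lemma IsWeight.setAverage_pos {n : ℕ} {w : (Fin n → ℝ) → ℝ} (hw : IsWeight w)
    {Q : Set (Fin n → ℝ)} (hQ : IsCube Q) : 0 < ⨍ x in Q, w x ∂volume := by
  rw [setAverage_eq, smul_eq_mul]
  refine mul_pos (inv_pos.2 ?_) ?_
  · exact ENNReal.toReal_pos hQ.volume_ne_zero hQ.volume_ne_top
  · rw [integral_pos_iff_support_of_nonneg_ae
      (ae_restrict_of_ae (hw.ae_pos.mono fun x hx => hx.le)) (hw.integrableOn hQ),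
      pos_iff_ne_zero]
    have : Function.support w =ᵐ[volume.restrict Q] univ := by
      rw [eventuallyEq_univ]
      filter_upwards [ae_restrict_of_ae hw.ae_pos] with x hx using hx.ne'
    rw [measure_congr this]
    simpa using hQ.volume_ne_zero

lemma MemAinfty.isWeight {n : ℕ} {w : (Fin n → ℝ) → ℝ} (hw : MemAinfty w) : IsWeight w := by
  obtain ⟨p, -, h, -⟩ := hw
  exact h

/-- Up to a power this is the `A_p` condition with `q = 1 / (p - 1)`; for `p = 1` it holds with
`q = 1`, since `A_1 ⊆ A_2`. -/
lemma MemAinfty.exists_power_condition {n : ℕ} {w : (Fin n → ℝ) → ℝ} (hw : MemAinfty w) :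
    ∃ q D : ℝ, 0 < q ∧ 0 < D ∧ ∀ Q, IsCube Q →
      (⨍⁻ x in Q, ENNReal.ofReal (w x) ∂volume) ^ q *
        ⨍⁻ x in Q, ENNReal.ofReal (w x) ^ (-q) ∂volume ≤
        ENNReal.ofReal D := by
  obtain ⟨p, hp, -, hC⟩ := hw
  suffices ∃ q : ℝ, ∃ C : ℝ≥0∞, 0 < q ∧ C ≠ ∞ ∧ ∀ Q, IsCube Q →
      (⨍⁻ x in Q, ENNReal.ofReal (w x) ∂volume) ^ q *
        ⨍⁻ x in Q, ENNReal.ofReal (w x) ^ (-q) ∂volume ≤ C by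
    obtain ⟨q, C, hq, hC, h⟩ := this
    refine ⟨q, C.toReal + 1, hq, by positivity, fun Q hQ => (h Q hQ).trans ?_⟩
    exact (ENNReal.ofReal_toReal hC).ge.trans (ENNReal.ofReal_le_ofReal (by linarith))
  rcases hp.eq_or_lt with rfl | hp
  · refine ⟨1, ApConst 1 w, one_pos, hC.ne, fun Q hQ => ?_⟩
    rw [ApConst, if_pos rfl]
    refine le_trans ?_ (le_iSup₂ (f := fun (Q : Set (Fin n → ℝ)) (_ : IsCube Q) =>
      (⨍⁻ y in Q, ENNReal.ofReal (w y) ∂volume) *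
        essSup (fun y => (ENNReal.ofReal (w y))⁻¹) (volume.restrict Q)) Q hQ)
    simp only [ENNReal.rpow_one, ENNReal.rpow_neg_one]
    gcongr
    refine (laverage_mono_ae (ENNReal.ae_le_essSup _)).trans ?_
    rw [setLAverage_const hQ.volume_ne_zero hQ.volume_ne_top]
  · have hp' : 0 < p - 1 := by linarith
    refine ⟨(p - 1)⁻¹, ApConst p w ^ (p - 1)⁻¹, by positivity,
      (ENNReal.rpow_lt_top_of_nonneg (by positivity) hC.ne).ne, fun Q hQ => ?_⟩
    rw [ApConst, if_neg hp.ne']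
    have h := le_iSup₂ (f := fun (Q : Set (Fin n → ℝ)) (_ : IsCube Q) =>
      (⨍⁻ y in Q, ENNReal.ofReal (w y) ∂volume) *
        (⨍⁻ y in Q, ENNReal.ofReal (w y) ^ (1 - p / (p - 1)) ∂volume) ^ (p - 1)) Q hQ
    refine le_trans (le_of_eq ?_) (ENNReal.rpow_le_rpow h (inv_nonneg.2 hp'.le))
    have he : 1 - p / (p - 1) = -(p - 1)⁻¹ := by field_simp; ring
    rw [ENNReal.mul_rpow_of_nonneg _ _ (inv_nonneg.2 hp'.le), ← ENNReal.rpow_mul,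
      mul_inv_cancel₀ hp'.ne', ENNReal.rpow_one, he]

/-- The power condition for real-valued averages, with the integrability it contains. -/
lemma MemAinfty.exists_real_power_condition {n : ℕ} {w : (Fin n → ℝ) → ℝ} (hw : MemAinfty w) :
    ∃ q D : ℝ, 0 < q ∧ 0 < D ∧ ∀ Q, IsCube Q → IntegrableOn (fun x => w x ^ (-q)) Q ∧
      (⨍ x in Q, w x ∂volume) ^ q * ⨍ x in Q, w x ^ (-q) ∂volume ≤ D := by
  have hw' := hw.isWeight
  obtain ⟨q, D, hq, hD, h⟩ := hw.exists_power_condition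
  refine ⟨q, D, hq, hD, fun Q hQ => ?_⟩
  have hpos : ∀ᵐ x ∂volume.restrict Q, 0 < w x := ae_restrict_of_ae hw'.ae_pos
  have hm := hw'.setAverage_pos hQ
  have h := h Q hQ
  have hcongr : ⨍⁻ x in Q, ENNReal.ofReal (w x) ^ (-q) ∂volume =
      ⨍⁻ x in Q, ENNReal.ofReal (w x ^ (-q)) ∂volume :=
    laverage_congr (hpos.mono fun x hx => ENNReal.ofReal_rpow_of_pos hx)
  rw [hw'.laverage_eq hQ, hcongr, ENNReal.ofReal_rpow_of_pos hm] at h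
  have hint : IntegrableOn (fun x => w x ^ (-q)) Q := by
    refine ⟨(hw'.aemeasurable.restrict.pow_const _).aestronglyMeasurable, ?_⟩
    rw [hasFiniteIntegral_iff_ofReal (hpos.mono fun x hx => (Real.rpow_pos_of_pos hx _).le)]
    have hfin : ⨍⁻ x in Q, ENNReal.ofReal (w x ^ (-q)) ∂volume ≠ ∞ := by
      intro htop
      rw [htop, ENNReal.mul_top (by simpa using Real.rpow_pos_of_pos hm q)] at h
      exact absurd h (by simp)
    rw [setLAverage_eq] at hfin
    by_contra hcon
    rw [not_lt, top_le_iff] at hcon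
    exact hfin (by rw [hcon, ENNReal.top_div_of_ne_top hQ.volume_ne_top])
  refine ⟨hint, ?_⟩
  rw [setLAverage_eq, ← ofReal_setAverage hint
    (hpos.mono fun x hx => (Real.rpow_pos_of_pos hx _).le), ← ENNReal.ofReal_mul (by positivity)] at h
  exact (ENNReal.ofReal_le_ofReal_iff hD.le).1 h

/-! ### The logarithm of a weight and the Hruščev constant -/

lemma MemAinfty.integrableOn_log {n : ℕ} {w : (Fin n → ℝ) → ℝ} (hw : MemAinfty w)
    {Q : Set (Fin n → ℝ)} (hQ : IsCube Q) : IntegrableOn (fun x => Real.log (w x)) Q := by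
  obtain ⟨q, D, hq, -, h⟩ := hw.exists_real_power_condition
  have hpos : ∀ᵐ x ∂volume.restrict Q, 0 < w x := ae_restrict_of_ae hw.isWeight.ae_pos
  refine Integrable.mono' ((hw.isWeight.integrableOn hQ).add ((h Q hQ).1.div_const q))
    hw.isWeight.aemeasurable.restrict.log.aestronglyMeasurable ?_
  filter_upwards [hpos] with x hx
  have h1 := Real.log_le_sub_one_of_pos hx
  have hxq : 0 < w x ^ (-q) := Real.rpow_pos_of_pos hx _
  have h2 : -q * Real.log (w x) ≤ w x ^ (-q) - 1 := by
    rw [← Real.log_rpow hx]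
    exact Real.log_le_sub_one_of_pos hxq
  have h3 : -Real.log (w x) ≤ w x ^ (-q) / q := by
    rw [le_div_iff₀ hq]
    linarith
  have h4 : 0 < w x ^ (-q) / q := by positivity
  rw [Real.norm_eq_abs, abs_le]
  simp only [Pi.add_apply]
  constructor <;> linarith

lemma MemAinfty.integrableOn_log_inv {n : ℕ} {w : (Fin n → ℝ) → ℝ} (hw : MemAinfty w)
    {Q : Set (Fin n → ℝ)} (hQ : IsCube Q) : IntegrableOn (fun x => Real.log (w x)⁻¹) Q := by
  simp only [Real.log_inv]
  exact (hw.integrableOn_log hQ).neg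

lemma setAverage_log_inv {n : ℕ} (w : (Fin n → ℝ) → ℝ) (Q : Set (Fin n → ℝ)) :
    ⨍ x in Q, Real.log (w x)⁻¹ ∂volume = -⨍ x in Q, Real.log (w x) ∂volume := by
  simp only [Real.log_inv, setAverage_eq, integral_neg, smul_neg]

/-- Jensen's inequality for the exponential bounds the geometric mean of `w⁻¹` by the power mean in
the power condition. -/
lemma MemAinfty.hruscevConst_lt_top {n : ℕ} {w : (Fin n → ℝ) → ℝ} (hw : MemAinfty w) :
    hruscevConst w < ∞ := by
  obtain ⟨q, D, hq, hD, h⟩ := hw.exists_real_power_condition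
  refine lt_of_le_of_lt (iSup₂_le fun Q hQ => ?_) (ENNReal.ofReal_lt_top (r := D ^ q⁻¹))
  have hlog := hw.integrableOn_log hQ
  have hm := hw.isWeight.setAverage_pos hQ
  obtain ⟨hint, hle⟩ := h Q hQ
  have hexp : (fun x => w x ^ (-q)) =ᵐ[volume.restrict Q]
      Real.exp ∘ fun x => -q * Real.log (w x) := by
    filter_upwards [ae_restrict_of_ae hw.isWeight.ae_pos] with x hx
    rw [Real.rpow_def_of_pos hx, Function.comp_apply, mul_comm]
  have hJ : Real.exp (-q * ⨍ x in Q, Real.log (w x) ∂volume) ≤ ⨍ x in Q, w x ^ (-q) ∂volume := by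
    have := convexOn_exp.map_set_average_le Real.continuous_exp.continuousOn isClosed_univ
      hQ.volume_ne_zero hQ.volume_ne_top (ae_of_all _ fun x => mem_univ _)
      (hlog.const_mul (-q)) (hint.congr hexp)
    rw [average_congr hexp]
    refine le_trans (le_of_eq ?_) this
    simp only [setAverage_eq, integral_const_mul, smul_eq_mul]
    congr 1
    ring
  rw [expAvgLogInv, if_pos (hw.integrableOn_log_inv hQ), hw.isWeight.laverage_eq hQ,
    setAverage_log_inv, ← ENNReal.ofReal_mul hm.le]
  refine ENNReal.ofReal_le_ofReal ?_
  rw [← Real.rpow_le_rpow_iff (by positivity) (by positivity) hq, ← Real.rpow_mul hD.le,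
    inv_mul_cancel₀ hq.ne', Real.rpow_one, Real.mul_rpow hm.le (Real.exp_nonneg _),
    ← Real.exp_mul]
  refine le_trans ?_ hle
  gcongr
  refine le_trans (le_of_eq ?_) hJ
  congr 1
  ring

/-- The definition of the Hruščev constant in logarithmic form. -/
lemma MemAinfty.log_average_le {n : ℕ} {w : (Fin n → ℝ) → ℝ} (hw : MemAinfty w)
    {Q : Set (Fin n → ℝ)} (hQ : IsCube Q) :
    0 < (hruscevConst w).toReal ∧ Real.log (⨍ x in Q, w x ∂volume) -
      ⨍ x in Q, Real.log (w x) ∂volume ≤ Real.log (hruscevConst w).toReal := by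
  have hm := hw.isWeight.setAverage_pos hQ
  have h : (⨍⁻ x in Q, ENNReal.ofReal (w x) ∂volume) * expAvgLogInv w Q ≤ hruscevConst w :=
    le_iSup₂ (f := fun (Q : Set (Fin n → ℝ)) (_ : IsCube Q) =>
      (⨍⁻ x in Q, ENNReal.ofReal (w x) ∂volume) * expAvgLogInv w Q) Q hQ
  rw [expAvgLogInv, if_pos (hw.integrableOn_log_inv hQ),
    hw.isWeight.laverage_eq hQ, setAverage_log_inv, ← ENNReal.ofReal_mul hm.le,
    ENNReal.ofReal_le_iff_le_toReal hw.hruscevConst_lt_top.ne] at h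
  have hpos : 0 < (⨍ x in Q, w x ∂volume) * Real.exp (-⨍ x in Q, Real.log (w x) ∂volume) := by
    positivity
  refine ⟨hpos.trans_le h, ?_⟩
  have := Real.log_le_log hpos h
  rwa [Real.log_mul hm.ne' (Real.exp_ne_zero _), Real.log_exp, ← sub_eq_add_neg] at this

/-- Jensen's inequality gives `1 ≤ [w]'_{A_∞}`, so the logarithmic factor stays away from `0`. -/
lemma MemAinfty.one_le_hruscevConst {n : ℕ} {w : (Fin n → ℝ) → ℝ} (hw : MemAinfty w) :
    1 ≤ (hruscevConst w).toReal := by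
  have hQ : IsCube (closedBall (0 : Fin n → ℝ) 1) := isCube_closedBall _ one_pos
  obtain ⟨hK, h⟩ := hw.log_average_le hQ
  have hm := hw.isWeight.setAverage_pos hQ
  have hexp : w =ᵐ[volume.restrict (closedBall (0 : Fin n → ℝ) 1)]
      Real.exp ∘ fun x => Real.log (w x) := by
    filter_upwards [ae_restrict_of_ae hw.isWeight.ae_pos] with x hx
    exact (Real.exp_log hx).symm
  have hJ := convexOn_exp.map_set_average_le Real.continuous_exp.continuousOn isClosed_univ
      hQ.volume_ne_zero hQ.volume_ne_top (ae_of_all _ fun x => mem_univ _)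
      (hw.integrableOn_log hQ) ((hw.isWeight.integrableOn hQ).congr hexp)
  have hJ' : Real.exp (⨍ x in closedBall (0 : Fin n → ℝ) 1, Real.log (w x) ∂volume) ≤
      ⨍ x in closedBall (0 : Fin n → ℝ) 1, w x ∂volume := by
    rw [average_congr hexp]
    exact hJ
  rw [← Real.le_log_iff_exp_le hm] at hJ'
  rw [← Real.log_nonneg_iff hK]
  linarith

/-- On every cube, `log w` is within a multiple of `log (2 [w]'_{A_∞})` of the logarithm of the mean
of `w`: the positive part of the difference is dominated by `w / w_Q`, and the mean of the
difference by the Hruščev constant. -/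
lemma MemAinfty.integral_abs_log_sub_le {n : ℕ} {w : (Fin n → ℝ) → ℝ} (hw : MemAinfty w)
    {Q : Set (Fin n → ℝ)} (hQ : IsCube Q) :
    ∫ x in Q, |Real.log (w x) - Real.log (⨍ x in Q, w x ∂volume)| ≤
      3 * Real.log (2 * (hruscevConst w).toReal) * volume.real Q := by
  obtain ⟨hK, h⟩ := hw.log_average_le hQ
  have hm := hw.isWeight.setAverage_pos hQ
  have hV : 0 < volume.real Q := ENNReal.toReal_pos hQ.volume_ne_zero hQ.volume_ne_top
  have hlog := hw.integrableOn_log hQ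
  have hwi := hw.isWeight.integrableOn hQ
  have hint : ∫ x in Q, w x = volume.real Q * ⨍ x in Q, w x ∂volume := by
    rw [setAverage_eq, smul_eq_mul, mul_inv_cancel_left₀ hV.ne']
  have hintlog : ∫ x in Q, Real.log (w x) = volume.real Q * ⨍ x in Q, Real.log (w x) ∂volume := by
    rw [setAverage_eq, smul_eq_mul, mul_inv_cancel_left₀ hV.ne']
  set m := ⨍ x in Q, w x ∂volume with hmdef
  have hc : IntegrableOn (fun _ : Fin n → ℝ => Real.log m) Q :=
    integrableOn_const hQ.volume_ne_top
  have hle : ∫ x in Q, |Real.log (w x) - Real.log m| ≤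
      ∫ x in Q, (2 / m * w x - (Real.log (w x) - Real.log m)) := by
    refine integral_mono_ae (hlog.sub hc).abs ((hwi.const_mul _).sub (hlog.sub hc)) ?_
    filter_upwards [ae_restrict_of_ae hw.isWeight.ae_pos] with x hx
    have h1 := Real.log_le_sub_one_of_pos (div_pos hx hm)
    rw [Real.log_div hx.ne' hm.ne'] at h1
    have h2 : 0 < w x / m := div_pos hx hm
    have h3 : 2 / m * w x = 2 * (w x / m) := by ring
    rw [h3]
    exact abs_le.2 ⟨by linarith, by linarith⟩
  have hsub : ∫ x in Q, (2 / m * w x - (Real.log (w x) - Real.log m)) =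
      2 / m * (∫ x in Q, w x) - ((∫ x in Q, Real.log (w x)) - volume.real Q * Real.log m) := by
    rw [← integral_const_mul, ← smul_eq_mul (volume.real Q), ← setIntegral_const,
      ← integral_sub hlog hc]
    exact integral_sub (hwi.const_mul _) (hlog.sub hc)
  rw [hsub, hint, hintlog] at hle
  rw [Real.log_mul two_ne_zero hK.ne']
  have hlog2 := Real.log_two_gt_d9
  have h5 : 2 / m * (volume.real Q * m) = 2 * volume.real Q := by field_simp
  have h6 := Real.log_nonneg hw.one_le_hruscevConst
  rw [h5] at hle
  nlinarith [hle, mul_le_mul_of_nonneg_left h hV.le, mul_nonneg h6 hV.le, mul_pos hV hV]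

/-! ### Finiteness of the Fujii–Wilson constant -/

lemma radius_le_of_closedBall_subset {n : ℕ} (hn : 0 < n) {c c' : Fin n → ℝ} {r r' : ℝ}
    (hr : 0 < r) (hr' : 0 < r') (h : closedBall c r ⊆ closedBall c' r') : r ≤ r' := by
  have := measure_mono (μ := volume) h
  rw [Real.volume_pi_closedBall _ hr.le, Real.volume_pi_closedBall _ hr'.le, Fintype.card_fin,
    ENNReal.ofReal_le_ofReal_iff (by positivity),
    pow_le_pow_iff_left₀ (by positivity) (by positivity) hn.ne'] at this
  linarith

/-- If the mean of `w` over a cube exceeds `t`, then `w` itself exceeds `c t` on at least half of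
the cube. -/
lemma MemAinfty.exists_volume_le_two_mul {n : ℕ} {w : (Fin n → ℝ) → ℝ} (hw : MemAinfty w) :
    ∃ c : ℝ, 0 < c ∧ ∀ R, IsCube R → ∀ t : ℝ, 0 < t → t < ⨍ x in R, w x ∂volume →
      volume R ≤ 2 * volume ({x | c * t < w x} ∩ R) := by
  obtain ⟨q, D, hq, hD, h⟩ := hw.exists_real_power_condition
  -- The constant is chosen so that `c ^ (-q) = 2 * D`.
  refine ⟨(2 * D) ^ (-q⁻¹), by positivity, fun R hR t ht htm => ?_⟩
  obtain ⟨hint, hle⟩ := h R hR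
  have hV : 0 < volume.real R := ENNReal.toReal_pos hR.volume_ne_zero hR.volume_ne_top
  have hcq : ((2 * D) ^ (-q⁻¹)) ^ (-q) = 2 * D := by
    rw [← Real.rpow_mul (by positivity), neg_mul_neg, inv_mul_cancel₀ hq.ne', Real.rpow_one]
  have hc : 0 < (2 * D) ^ (-q⁻¹) := by positivity
  generalize (2 * D) ^ (-q⁻¹) = c at hcq hc
  have hpos : ∀ᵐ x ∂volume.restrict R, 0 < w x := ae_restrict_of_ae hw.isWeight.ae_pos
  have hM := mul_meas_ge_le_integral_of_nonneg (μ := volume.restrict R)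
    (hpos.mono fun x hx => (Real.rpow_pos_of_pos hx _).le) hint ((c * t) ^ (-q))
  have hI : ∫ x in R, w x ^ (-q) = volume.real R * ⨍ x in R, w x ^ (-q) ∂volume := by
    rw [setAverage_eq, smul_eq_mul, mul_inv_cancel_left₀ hV.ne']
  have hcov : volume R ≤ volume ({x | c * t < w x} ∩ R) +
      volume.restrict R {x | (c * t) ^ (-q) ≤ w x ^ (-q)} := by
    rw [← Measure.restrict_apply' hR.measurableSet]
    calc volume R = volume.restrict R univ := by simp
      _ ≤ volume.restrict R ({x | c * t < w x} ∪ {x | (c * t) ^ (-q) ≤ w x ^ (-q)}) := by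
          refine measure_mono_ae ?_
          filter_upwards [hpos] with x hx _
          rcases lt_or_ge (c * t) (w x) with h' | h'
          · exact Or.inl h'
          · exact Or.inr (Real.rpow_le_rpow_of_nonpos hx h' (by linarith))
      _ ≤ _ := measure_union_le _ _
  generalize {x | (c * t) ^ (-q) ≤ w x ^ (-q)} = E at hM hcov
  have hfin : volume ({x | c * t < w x} ∩ R) ≠ ∞ :=
    measure_ne_top_of_subset inter_subset_right hR.volume_ne_top
  have hfin' : volume.restrict R E ≠ ∞ :=
    ne_top_of_le_ne_top hR.volume_ne_top ((measure_mono (subset_univ _)).trans (by simp))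
  have hcov' := ENNReal.toReal_mono (ENNReal.add_ne_top.2 ⟨hfin, hfin'⟩) hcov
  rw [ENNReal.toReal_add hfin hfin'] at hcov'
  -- Markov's inequality leaves at most half of the cube for `w ≤ c t`.
  have hhalf : (volume.restrict R E).toReal ≤
      volume.real R / 2 := by
    rw [hI, Real.mul_rpow hc.le ht.le, hcq, Real.rpow_neg ht.le] at hM
    have htq : 0 < t ^ q := Real.rpow_pos_of_pos ht _
    have hσ : 0 ≤ ⨍ x in R, w x ^ (-q) ∂volume := by
      rw [setAverage_eq, smul_eq_mul]
      exact mul_nonneg (by positivity) (integral_nonneg_of_ae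
        (hpos.mono fun x hx => (Real.rpow_pos_of_pos hx _).le))
    have h1 : t ^ q * ⨍ x in R, w x ^ (-q) ∂volume ≤ D :=
      (mul_le_mul_of_nonneg_right (Real.rpow_le_rpow ht.le htm.le hq.le) hσ).trans hle
    have h2 := mul_le_mul_of_nonneg_left hM htq.le
    have h3 : t ^ q * (2 * D * (t ^ q)⁻¹ * (volume.restrict R).real E) =
        D * (2 * (volume.restrict R).real E) := by
      field_simp
    have h4 : t ^ q * (volume.real R * ⨍ x in R, w x ^ (-q) ∂volume) ≤ D * volume.real R := by
      nlinarith
    have h5 := le_of_mul_le_mul_left ((h3 ▸ h2).trans h4) hD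
    rw [Measure.real] at h5
    linarith
  rw [← ENNReal.toReal_le_toReal hR.volume_ne_top (ENNReal.mul_ne_top (by simp) hfin),
    ENNReal.toReal_mul, ENNReal.toReal_ofNat]
  rw [Measure.real] at hhalf
  linarith

lemma laverage_enorm_indicator {n : ℕ} {w : (Fin n → ℝ) → ℝ} (hw : IsWeight w)
    {Q : Set (Fin n → ℝ)} (hQ : IsCube Q) (R : Set (Fin n → ℝ)) :
    ⨍⁻ y in R, ‖Q.indicator w y‖ₑ ∂volume =
      (∫⁻ y in R ∩ Q, ENNReal.ofReal (w y)) / volume R := by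
  rw [setLAverage_eq]
  congr 1
  simp_rw [enorm_indicator_eq_indicator_enorm]
  rw [lintegral_indicator hQ.measurableSet, Measure.restrict_restrict hQ.measurableSet, inter_comm]
  refine lintegral_congr_ae (ae_restrict_of_ae (hw.ae_pos.mono fun x hx => ?_))
  dsimp only
  rw [← ofReal_norm, Real.norm_of_nonneg hx.le]

/-- The maximal function of `w χ_Q` only needs the cubes contained in `Q`. -/
lemma exists_cube_of_lt_maximalFunction {n : ℕ} {w : (Fin n → ℝ) → ℝ} (hw : IsWeight w)
    {Q : Set (Fin n → ℝ)} (hQ : IsCube Q) {x : Fin n → ℝ} (hx : x ∈ Q) {t : ℝ}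
    (h : ENNReal.ofReal t < maximalFunction (Q.indicator w) x) :
    ∃ R, IsCube R ∧ R ⊆ Q ∧ x ∈ R ∧ t < ⨍ y in R, w y ∂volume := by
  simp only [maximalFunction, lt_iSup_iff] at h
  obtain ⟨R, hR, hxR, h⟩ := h
  obtain ⟨R', hR', hsub, hinter, hvol⟩ := hQ.exists_subset_cube hR
  refine ⟨R', hR', hsub, hinter ⟨hxR, hx⟩, ?_⟩
  rw [laverage_enorm_indicator hw hQ] at h
  have h' : ENNReal.ofReal t < ⨍⁻ y in R', ENNReal.ofReal (w y) ∂volume := by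
    refine h.trans_le ?_
    rw [setLAverage_eq]
    gcongr
  rw [hw.laverage_eq hR'] at h'
  exact (ENNReal.ofReal_lt_ofReal_iff (hw.setAverage_pos hR')).1 h'

/-- By the covering lemma, the distribution function of the maximal function of `w χ_Q` on `Q` is
bounded by that of a multiple of `w`. -/
lemma MemAinfty.fujiiWilsonConst_lt_top {n : ℕ} (hn : 0 < n) {w : (Fin n → ℝ) → ℝ}
    (hw : MemAinfty w) : fujiiWilsonConst w < ∞ := by
  obtain ⟨c, hc, h⟩ := hw.exists_volume_le_two_mul
  have hC : (2 * 5 ^ n : ℝ≥0∞) ≠ ∞ := ENNReal.mul_ne_top (by simp) (by simp)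
  refine lt_of_le_of_lt (iSup₂_le fun Q hQ => ?_)
    (ENNReal.mul_lt_top hC.lt_top (ENNReal.ofReal_lt_top (r := c⁻¹)))
  refine ENNReal.div_le_of_le_mul ?_
  rw [mul_assoc, ← lintegral_const_mul' _ _ ENNReal.ofReal_ne_top]
  refine lintegral_le_of_meas_lt_le _
    (hw.isWeight.aemeasurable.restrict.ennreal_ofReal.const_mul _) hC fun t ht => ?_
  rw [Measure.restrict_apply' hQ.measurableSet, Measure.restrict_apply' hQ.measurableSet]
  obtain ⟨b, L, hL, hQb⟩ := hQ.exists_eq_closedBall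
  let T : Set ((Fin n → ℝ) × ℝ) := {B | 0 < B.2 ∧ closedBall B.1 B.2 ⊆ Q ∧
    t < ⨍ y in closedBall B.1 B.2, w y ∂volume}
  obtain ⟨u, -, hu, hcov, hsum⟩ := exists_countable_covering
    (S := {x | ENNReal.ofReal t < maximalFunction (Q.indicator w) x} ∩ Q)
    (F := {x | c * t < w x} ∩ Q) (T := T) (R := L)
    (fun B hB => ⟨hB.1, radius_le_of_closedBall_subset hn hB.1 hL (hQb ▸ hB.2.1)⟩)
    (fun x hx => by
      obtain ⟨R, hR, hRQ, hxR, htR⟩ :=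
        exists_cube_of_lt_maximalFunction hw.isWeight hQ hx.2 hx.1
      obtain ⟨c', r, hr, rfl⟩ := hR.exists_eq_closedBall
      exact ⟨(c', r), ⟨hr, hRQ, htR⟩, hxR⟩)
    (fun B hB => by
      rw [inter_assoc, inter_eq_right.2 hB.2.1]
      exact h _ (isCube_closedBall _ hB.1) t ht hB.2.2)
  calc volume ({x | ENNReal.ofReal t < maximalFunction (Q.indicator w) x} ∩ Q)
      ≤ volume (⋃ B ∈ u, closedBall B.1 (5 * B.2)) := measure_mono hcov
    _ ≤ ∑' B : u, volume (closedBall B.1.1 (5 * B.1.2)) := measure_biUnion_le _ hu _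
    _ ≤ 2 * 5 ^ n * volume ({x | c * t < w x} ∩ Q) := hsum
    _ ≤ _ := by
      gcongr
      intro hx
      show ENNReal.ofReal t < ENNReal.ofReal c⁻¹ * ENNReal.ofReal (w x)
      rw [← ENNReal.ofReal_mul (by positivity),
        ENNReal.ofReal_lt_ofReal_iff_of_nonneg ht.le, inv_mul_eq_div, lt_div_iff₀ hc, mul_comm]
      exact hx

/-! ### The mean oscillation of `w` and the Fujii–Wilson constant -/

/-- By the Lebesgue differentiation theorem, `f ≤ M f` almost everywhere. -/
lemma ae_ofReal_le_maximalFunction {n : ℕ} {f : (Fin n → ℝ) → ℝ} (hf : LocallyIntegrable f) :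
    ∀ᵐ x, ENNReal.ofReal (f x) ≤ maximalFunction f x := by
  filter_upwards [IsUnifLocDoublingMeasure.ae_tendsto_average volume hf 1] with x hx
  have h0 : Tendsto (fun r : ℝ => r) (𝓝[>] 0) (𝓝[>] 0) := tendsto_id
  have h := hx (fun _ => x) (fun r : ℝ => r) h0 (by
    filter_upwards [self_mem_nhdsWithin] with r hr
    exact mem_closedBall_self (by rw [one_mul]; exact (mem_Ioi.1 hr).le))
  refine le_of_tendsto ((ENNReal.continuous_ofReal.tendsto _).comp h) ?_
  filter_upwards [self_mem_nhdsWithin] with r hr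
  have hr : 0 < r := hr
  calc ENNReal.ofReal (⨍ y in closedBall x r, f y ∂volume)
      ≤ ‖⨍ y in closedBall x r, f y ∂volume‖ₑ := by
        rw [← ofReal_norm]
        exact ENNReal.ofReal_le_ofReal (le_abs_self _)
    _ ≤ ⨍⁻ y in closedBall x r, ‖f y‖ₑ ∂volume := enorm_integral_le_lintegral_enorm _
    _ ≤ maximalFunction f x :=
        le_iSup₂_of_le (closedBall x r) (isCube_closedBall x hr)
          (le_iSup_of_le (mem_closedBall_self hr.le) le_rfl)

/-- Since `M (w χ_Q)` is at least `max w w_Q` on `Q`, the excess `[w]_{A_∞} - 1` controls the mean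
oscillation of `w` relative to its mean. -/
lemma MemAinfty.integral_max_sub_le {n : ℕ} (hn : 0 < n) {w : (Fin n → ℝ) → ℝ}
    (hw : MemAinfty w) {Q : Set (Fin n → ℝ)} (hQ : IsCube Q) :
    ∫ x in Q, max ((⨍ y in Q, w y ∂volume) - w x) 0 ≤
      ((fujiiWilsonConst w).toReal - 1) * (volume.real Q * ⨍ y in Q, w y ∂volume) := by
  have hm := hw.isWeight.setAverage_pos hQ
  have hwi := hw.isWeight.integrableOn hQ
  have hV : 0 < volume.real Q := ENNReal.toReal_pos hQ.volume_ne_zero hQ.volume_ne_top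
  have hint : ∫ x in Q, w x = volume.real Q * ⨍ x in Q, w x ∂volume := by
    rw [setAverage_eq, smul_eq_mul, mul_inv_cancel_left₀ hV.ne']
  have hpos : ∀ᵐ x ∂volume.restrict Q, 0 ≤ w x :=
    ae_restrict_of_ae (hw.isWeight.ae_pos.mono fun x hx => hx.le)
  have hav : ⨍⁻ y in Q, ‖Q.indicator w y‖ₑ ∂volume =
      ENNReal.ofReal (⨍ y in Q, w y ∂volume) := by
    rw [laverage_enorm_indicator hw.isWeight hQ, inter_self, ← hw.isWeight.laverage_eq hQ,
      setLAverage_eq]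
  set m := ⨍ y in Q, w y ∂volume with hmdef
  have hmaxi : IntegrableOn (fun x => max (m - w x) 0) Q :=
    ((integrableOn_const hQ.volume_ne_top).sub hwi).pos_part
  have hle : ∫⁻ x in Q, ENNReal.ofReal (w x + max (m - w x) 0) ≤
      ∫⁻ x in Q, maximalFunction (Q.indicator w) x := by
    refine lintegral_mono_ae ?_
    have hind : LocallyIntegrable (Q.indicator w) :=
      (hwi.integrable_indicator hQ.measurableSet).locallyIntegrable
    filter_upwards [ae_restrict_of_ae (ae_ofReal_le_maximalFunction hind),
      ae_restrict_mem hQ.measurableSet] with x hx hxQ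
    rw [indicator_of_mem hxQ] at hx
    have h2 : ENNReal.ofReal m ≤ maximalFunction (Q.indicator w) x :=
      hav.ge.trans (le_iSup₂_of_le Q hQ (le_iSup_of_le hxQ le_rfl))
    have h3 : w x + max (m - w x) 0 = max m (w x) := by
      rw [← max_add_add_left]
      simp
    rw [h3, ENNReal.ofReal_max]
    exact max_le h2 hx
  have hv0 : ∫⁻ x in Q, ENNReal.ofReal (w x) = ENNReal.ofReal (∫ x in Q, w x) :=
    (ofReal_integral_eq_lintegral_ofReal hwi hpos).symm
  have hFW : ∫⁻ x in Q, maximalFunction (Q.indicator w) x ≤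
      fujiiWilsonConst w * ENNReal.ofReal (∫ x in Q, w x) := by
    rw [← hv0]
    have h := le_iSup₂ (f := fun (Q : Set (Fin n → ℝ)) (_ : IsCube Q) =>
      (∫⁻ x in Q, maximalFunction (Q.indicator w) x) / ∫⁻ x in Q, ENNReal.ofReal (w x)) Q hQ
    rwa [ENNReal.div_le_iff] at h
    · rw [hv0, hint]
      exact (ENNReal.ofReal_pos.2 (mul_pos hV hm)).ne'
    · rw [hv0]
      exact ENNReal.ofReal_ne_top
  have h := hle.trans hFW
  have hsum : ∫⁻ x in Q, ENNReal.ofReal (w x + max (m - w x) 0) =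
      ENNReal.ofReal (∫ x in Q, (w x + max (m - w x) 0)) :=
    (ofReal_integral_eq_lintegral_ofReal (hwi.add hmaxi)
      (hpos.mono fun x hx => add_nonneg hx (le_max_right _ _))).symm
  rw [hsum, ← ENNReal.ofReal_toReal (hw.fujiiWilsonConst_lt_top hn).ne,
    ← ENNReal.ofReal_mul ENNReal.toReal_nonneg, ENNReal.ofReal_le_ofReal_iff
      (by rw [hint]; positivity), integral_add hwi hmaxi, hint] at h
  linarith

lemma MemAinfty.one_le_fujiiWilsonConst {n : ℕ} (hn : 0 < n) {w : (Fin n → ℝ) → ℝ}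
    (hw : MemAinfty w) : 1 ≤ (fujiiWilsonConst w).toReal := by
  have hQ : IsCube (closedBall (0 : Fin n → ℝ) 1) := isCube_closedBall _ one_pos
  have h := (integral_nonneg fun x => le_max_right _ _).trans (hw.integral_max_sub_le hn hQ)
  have hV : 0 < volume.real (closedBall (0 : Fin n → ℝ) 1) :=
    ENNReal.toReal_pos hQ.volume_ne_zero hQ.volume_ne_top
  have := nonneg_of_mul_nonneg_left h (mul_pos hV (hw.isWeight.setAverage_pos hQ))
  linarith

/-! ### Stopping balls for a small set -/

/-- Around almost every point of `F` in a ball of radius `r`, the radii `r / 5 ^ k` contain a first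
one at which `F` has density at least one half. The balls of these radii are selected by the
covering lemma. -/
lemma exists_stopping_balls {n : ℕ} {c : Fin n → ℝ} {r : ℝ} (hr : 0 < r) {F : Set (Fin n → ℝ)}
    (hF : 2 * volume F < volume (closedBall c r)) :
    ∃ u : Set ((Fin n → ℝ) × ℝ), u.Countable ∧
      (∀ B ∈ u, 0 < B.2 ∧ closedBall B.1 (5 * B.2) ⊆ closedBall c (2 * r) ∧
        2 * volume (F ∩ closedBall B.1 (5 * B.2)) ≤ volume (closedBall B.1 (5 * B.2))) ∧
      (∀ᵐ x ∂volume.restrict F, x ∈ closedBall c r → x ∈ ⋃ B ∈ u, closedBall B.1 (5 * B.2)) ∧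
      ∑' B : u, volume (closedBall B.1.1 (5 * B.1.2)) ≤ 2 * 5 ^ n * volume F := by
  let T : Set ((Fin n → ℝ) × ℝ) := {B | (0 < B.2 ∧ B.2 ≤ r) ∧
    closedBall B.1 (5 * B.2) ⊆ closedBall c (2 * r) ∧
    2 * volume (F ∩ closedBall B.1 (5 * B.2)) ≤ volume (closedBall B.1 (5 * B.2)) ∧
    volume (closedBall B.1 B.2) ≤ 2 * volume (F ∩ closedBall B.1 B.2)}
  obtain ⟨u, huT, hu, hcov, hsum⟩ := exists_countable_covering
    (S := {x | ∃ B ∈ T, x ∈ closedBall B.1 B.2}) (F := F) (T := T) (R := r)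
    (fun B hB => hB.1) (fun x hx => hx) (fun B hB => hB.2.2.2)
  refine ⟨u, hu, fun B hB => ⟨(huT hB).1.1, (huT hB).2.1, (huT hB).2.2.1⟩, ?_, hsum⟩
  filter_upwards [IsUnifLocDoublingMeasure.ae_tendsto_measure_inter_div volume F 1] with x hx hxc
  refine hcov ?_
  have hk0 (k : ℕ) : 0 < r * (1 / 5) ^ k := by positivity
  have hlim : Tendsto (fun k : ℕ => r * (1 / 5) ^ k) atTop (𝓝[>] 0) := by
    refine tendsto_nhdsWithin_iff.2 ⟨?_, Eventually.of_forall hk0⟩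
    simpa using (tendsto_pow_atTop_nhds_zero_of_lt_one (r := (1 / 5 : ℝ)) (by norm_num)
      (by norm_num)).const_mul r
  have hdens := hx (fun _ => x) (fun k : ℕ => r * (1 / 5) ^ k) hlim
    (Eventually.of_forall fun k => mem_closedBall_self (by rw [one_mul]; exact (hk0 k).le))
  have hex : ∃ k : ℕ, volume (closedBall x (r * (1 / 5) ^ k)) ≤
      2 * volume (F ∩ closedBall x (r * (1 / 5) ^ k)) := by
    have hhalf : (2⁻¹ : ℝ≥0∞) < 1 := by simp
    obtain ⟨k, hk⟩ := (hdens.eventually (lt_mem_nhds hhalf)).exists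
    refine ⟨k, ?_⟩
    have hQ := isCube_closedBall x (hk0 k)
    rw [ENNReal.lt_div_iff_mul_lt (Or.inl hQ.volume_ne_zero) (Or.inl hQ.volume_ne_top)] at hk
    calc volume (closedBall x (r * (1 / 5) ^ k))
        = 2 * (2⁻¹ * volume (closedBall x (r * (1 / 5) ^ k))) := by
          rw [← mul_assoc, ENNReal.mul_inv_cancel (by simp) (by simp), one_mul]
      _ ≤ _ := by gcongr
  classical
  obtain ⟨k, hk, hmin⟩ : ∃ k : ℕ, volume (closedBall x (r * (1 / 5) ^ k)) ≤
      2 * volume (F ∩ closedBall x (r * (1 / 5) ^ k)) ∧ ∀ j < k,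
      ¬ volume (closedBall x (r * (1 / 5) ^ j)) ≤
        2 * volume (F ∩ closedBall x (r * (1 / 5) ^ j)) :=
    ⟨Nat.find hex, Nat.find_spec hex, fun j hj => Nat.find_min hex hj⟩
  -- At the radius `r` itself the density is less than one half, because `F` is small.
  have hkpos : k ≠ 0 := by
    rintro rfl
    rw [pow_zero, mul_one] at hk
    have hvol : volume (closedBall x r) = volume (closedBall c r) := by
      rw [Real.volume_pi_closedBall _ hr.le, Real.volume_pi_closedBall _ hr.le]
    rw [hvol] at hk
    refine absurd (hk.trans ?_) (not_le.2 hF)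
    gcongr
    exact inter_subset_left
  obtain ⟨j, rfl⟩ := Nat.exists_eq_succ_of_ne_zero hkpos
  have h5 : 5 * (r * (1 / 5) ^ (j + 1)) = r * (1 / 5) ^ j := by ring
  have hpow (i : ℕ) : r * (1 / 5) ^ i ≤ r :=
    mul_le_of_le_one_right hr.le (pow_le_one₀ (by norm_num) (by norm_num))
  refine ⟨(x, r * (1 / 5) ^ (j + 1)), ⟨⟨hk0 _, hpow _⟩, ?_, ?_, hk⟩, mem_closedBall_self (hk0 _).le⟩
  · dsimp only
    rw [h5]
    refine closedBall_subset_closedBall' ?_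
    linarith [hpow j, mem_closedBall.1 hxc]
  · dsimp only
    rw [h5]
    exact (not_le.1 (hmin j (Nat.lt_succ_self j))).le

/-! ### The oscillation of `log w` -/

/-- If `w < A / 2` on at most half of a cube, then the mean of `w` over the cube is at least
`A / 4`. -/
lemma IsWeight.quarter_le_average {n : ℕ} {w : (Fin n → ℝ) → ℝ} (hw : IsWeight w)
    {B : Set (Fin n → ℝ)} (hB : IsCube B) {A : ℝ}
    (hAB : 2 * volume ({x | w x < A / 2} ∩ B) ≤ volume B) : A / 4 ≤ ⨍ x in B, w x ∂volume := by
  rcases le_or_gt A 0 with hA | hA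
  · linarith [hw.setAverage_pos hB]
  have hV : 0 < volume.real B := ENNReal.toReal_pos hB.volume_ne_zero hB.volume_ne_top
  have hM := mul_meas_ge_le_integral_of_nonneg (μ := volume.restrict B)
    (ae_restrict_of_ae (hw.ae_pos.mono fun x hx => hx.le)) (hw.integrableOn hB) (A / 2)
  have hcov : volume B ≤ volume ({x | w x < A / 2} ∩ B) +
      volume.restrict B {x | A / 2 ≤ w x} := by
    rw [← Measure.restrict_apply' hB.measurableSet]
    calc volume B = volume.restrict B univ := by simp
      _ ≤ volume.restrict B ({x | w x < A / 2} ∪ {x | A / 2 ≤ w x}) :=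
          measure_mono fun x _ => lt_or_ge (w x) (A / 2)
      _ ≤ _ := measure_union_le _ _
  have hfin : volume ({x | w x < A / 2} ∩ B) ≠ ∞ :=
    measure_ne_top_of_subset inter_subset_right hB.volume_ne_top
  have hfin' : volume.restrict B {x | A / 2 ≤ w x} ≠ ∞ :=
    ne_top_of_le_ne_top hB.volume_ne_top ((measure_mono (subset_univ _)).trans (by simp))
  have h1 := ENNReal.toReal_mono (ENNReal.add_ne_top.2 ⟨hfin, hfin'⟩) hcov
  rw [ENNReal.toReal_add hfin hfin'] at h1
  have h2 := ENNReal.toReal_mono hB.volume_ne_top hAB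
  rw [ENNReal.toReal_mul, ENNReal.toReal_ofNat] at h2
  rw [setAverage_eq, smul_eq_mul, inv_mul_eq_div, le_div_iff₀ hV]
  simp only [Measure.real] at *
  nlinarith

/-- Off the set where `w` is less than half of its mean, `log w` is close to the logarithm of the
mean as soon as `w` is close to the mean. The right-hand side is `2 |a - A| / A`, written so that the
term `a - A` integrates to zero when `A` is the mean. -/
lemma abs_log_sub_log_le {a A : ℝ} (hA : 0 < A) (ha : A / 2 ≤ a) :
    |Real.log a - Real.log A| ≤ 2 / A * (2 * max (A - a) 0 + (a - A)) := by
  have ha0 : 0 < a := by linarith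
  have h1 := Real.log_le_sub_one_of_pos (div_pos ha0 hA)
  have h2 := Real.log_le_sub_one_of_pos (div_pos hA ha0)
  rw [Real.log_div ha0.ne' hA.ne', div_sub_one hA.ne'] at h1
  rw [Real.log_div hA.ne' ha0.ne', div_sub_one ha0.ne'] at h2
  have key : 2 / A * |a - A| ≤ 2 / A * (2 * max (A - a) 0 + (a - A)) := by
    gcongr
    exact abs_le.2 ⟨by linarith [le_max_left (A - a) 0], by
      linarith [le_max_right (A - a) 0]⟩
  refine le_trans ?_ key
  rw [div_mul_eq_mul_div]
  have hx : (a - A) / A ≤ 2 * |a - A| / A := by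
    gcongr
    linarith [le_abs_self (a - A), abs_nonneg (a - A)]
  have hy : (A - a) / a ≤ 2 * |a - A| / A := by
    rw [div_le_div_iff₀ ha0 hA]
    nlinarith [neg_abs_le (a - A), abs_nonneg (a - A)]
  exact abs_le.2 ⟨by linarith, by linarith⟩

/-- On a cube where `w < A / 2` holds on at most half of the volume, the part of the oscillation of
`log w` around `log A` coming from `{w < A / 2}` is controlled by the Hruščev constant. -/
lemma MemAinfty.lintegral_abs_log_sub_le {n : ℕ} {w : (Fin n → ℝ) → ℝ} (hw : MemAinfty w)
    {B : Set (Fin n → ℝ)} (hB : IsCube B) {A : ℝ} (hA : 0 < A)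
    (hAB : 2 * volume ({x | w x < A / 2} ∩ B) ≤ volume B) :
    ∫⁻ x in B, {x | w x < A / 2}.indicator
        (fun x => ENNReal.ofReal |Real.log (w x) - Real.log A|) x ≤
      ENNReal.ofReal (5 * Real.log (2 * (hruscevConst w).toReal)) * volume B := by
  have hb := hw.isWeight.quarter_le_average hB hAB
  have hbpos := hw.isWeight.setAverage_pos hB
  have hJ := hw.integral_abs_log_sub_le hB
  set b := ⨍ x in B, w x ∂volume with hbdef
  set L := Real.log (2 * (hruscevConst w).toReal) with hL
  have hlog2L : Real.log 2 ≤ L := Real.log_le_log two_pos (by linarith [hw.one_le_hruscevConst])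
  have hlog4 : Real.log A ≤ Real.log b + 2 * Real.log 2 := by
    have h4 : 2 * Real.log 2 = Real.log 4 := by
      rw [← Real.log_rpow two_pos]
      norm_num
    rw [h4, ← Real.log_mul hbpos.ne' (by norm_num)]
    exact Real.log_le_log hA (by linarith)
  have hL0 : 0 < L := (Real.log_pos one_lt_two).trans_le hlog2L
  have hc (a : ℝ) : IntegrableOn (fun _ : Fin n → ℝ => a) B := integrableOn_const hB.volume_ne_top
  have hi : IntegrableOn (fun x => |Real.log (w x) - Real.log b|) B :=
    ((hw.integrableOn_log hB).sub (hc _)).abs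
  calc ∫⁻ x in B, {x | w x < A / 2}.indicator
        (fun x => ENNReal.ofReal |Real.log (w x) - Real.log A|) x
      ≤ ∫⁻ x in B, ENNReal.ofReal (2 * L + |Real.log (w x) - Real.log b|) := by
        refine lintegral_mono_ae ?_
        filter_upwards [ae_restrict_of_ae hw.isWeight.ae_pos] with x hx
        by_cases hxA : w x < A / 2
        · rw [indicator_of_mem (s := {x | w x < A / 2}) hxA]
          refine ENNReal.ofReal_le_ofReal ?_
          have h1 : Real.log (w x) ≤ Real.log A := Real.log_le_log hx (by linarith)
          rw [abs_of_nonpos (by linarith)]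
          linarith [neg_abs_le (Real.log (w x) - Real.log b)]
        · rw [indicator_of_notMem (s := {x | w x < A / 2}) hxA]
          exact zero_le
    _ = ENNReal.ofReal (∫ x in B, (2 * L + |Real.log (w x) - Real.log b|)) :=
        (ofReal_integral_eq_lintegral_ofReal ((hc _).add hi)
          (ae_of_all _ fun x => add_nonneg (by linarith) (abs_nonneg _))).symm
    _ ≤ ENNReal.ofReal (5 * L * volume.real B) := by
        refine ENNReal.ofReal_le_ofReal ?_
        rw [integral_add (hc _) hi, setIntegral_const, smul_eq_mul]
        linarith
    _ = ENNReal.ofReal (5 * L) * volume B := by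
        rw [ENNReal.ofReal_mul (by positivity), Measure.real, ENNReal.ofReal_toReal hB.volume_ne_top]

/-- For a small excess `δ = [w]_{A_∞} - 1`, the function `log w` is close to a constant on every
ball: the set where `w` is less than half of its mean over the double ball has volume at most a
multiple of `δ`, and it is covered by stopping balls on which the Hruščev constant takes over. -/
lemma MemAinfty.lintegral_abs_log_sub_le_of_small {n : ℕ} (hn : 0 < n) {w : (Fin n → ℝ) → ℝ}
    (hw : MemAinfty w) (hδ : ((fujiiWilsonConst w).toReal - 1) * (4 * 2 ^ n) < 1)
    {Q : Set (Fin n → ℝ)} (hQ : IsCube Q) :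
    ∃ a : ℝ, ∫⁻ x in Q, ENNReal.ofReal |Real.log (w x) - a| ≤
      ENNReal.ofReal (28 * 10 ^ n * Real.log (2 * (hruscevConst w).toReal) *
        ((fujiiWilsonConst w).toReal - 1)) * volume Q := by
  have hδ0 := hw.one_le_fujiiWilsonConst hn
  obtain ⟨c, r, hr, rfl⟩ := hQ.exists_eq_closedBall
  set P := closedBall c (2 * r) with hPdef
  have hP : IsCube P := isCube_closedBall c (by positivity)
  have hQP : closedBall c r ⊆ P := closedBall_subset_closedBall (by linarith)
  have hdef := hw.integral_max_sub_le hn hP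
  have hA := hw.isWeight.setAverage_pos hP
  have hwi := hw.isWeight.integrableOn hP
  have hVP : 0 < volume.real P := ENNReal.toReal_pos hP.volume_ne_zero hP.volume_ne_top
  have hVQ : 0 < volume.real (closedBall c r) :=
    ENNReal.toReal_pos hQ.volume_ne_zero hQ.volume_ne_top
  have hint : ∫ x in P, w x = volume.real P * ⨍ x in P, w x ∂volume := by
    rw [setAverage_eq, smul_eq_mul, mul_inv_cancel_left₀ hVP.ne']
  have hvol : volume.real P = 2 ^ n * volume.real (closedBall c r) := by
    rw [Measure.real, hPdef, volume_closedBall_mul c c (by norm_num) hr.le, ENNReal.toReal_mul]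
    simp [Measure.real]
  set A := ⨍ x in P, w x ∂volume with hAdef
  set L := Real.log (2 * (hruscevConst w).toReal) with hL
  set δ := (fujiiWilsonConst w).toReal - 1 with hδdef
  have hδ0' : 0 ≤ δ := by linarith
  have hlog2L : Real.log 2 ≤ L := Real.log_le_log two_pos (by linarith [hw.one_le_hruscevConst])
  have hL1 : 1 / 2 ≤ L := by linarith [Real.log_two_gt_d9]
  have hc (a : ℝ) : IntegrableOn (fun _ : Fin n → ℝ => a) P := integrableOn_const hP.volume_ne_top
  have hmaxi : IntegrableOn (fun x => max (A - w x) 0) P := ((hc _).sub hwi).pos_part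
  set F := {x | w x < A / 2} ∩ P with hFdef
  have hFfin : volume F ≠ ∞ := measure_ne_top_of_subset inter_subset_right hP.volume_ne_top
  -- Since `A - w ≥ A / 2` on `F`, Markov's inequality bounds the volume of `F`.
  have hFvol : volume.real F ≤ 2 * δ * volume.real P := by
    have hM := mul_meas_ge_le_integral_of_nonneg (μ := volume.restrict P)
      (ae_of_all _ fun x => le_max_right (A - w x) 0) hmaxi (A / 2)
    have hsub : volume.real F ≤ (volume.restrict P).real {x | A / 2 ≤ max (A - w x) 0} := by
      refine ENNReal.toReal_mono ?_ ?_
      · exact ne_top_of_le_ne_top hP.volume_ne_top ((measure_mono (subset_univ _)).trans (by simp))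
      · rw [Measure.restrict_apply' hP.measurableSet]
        refine measure_mono (inter_subset_inter_left _ fun x hx => ?_)
        have hx : w x < A / 2 := hx
        exact le_max_of_le_left (b := A - w x) (by linarith)
    have h1 : A / 2 * volume.real F ≤ A / 2 * (2 * δ * volume.real P) := by
      calc A / 2 * volume.real F ≤ _ := mul_le_mul_of_nonneg_left hsub (by linarith)
        _ ≤ _ := hM
        _ ≤ _ := hdef
        _ = _ := by ring
    exact le_of_mul_le_mul_left h1 (by linarith)
  have hFsmall : 2 * volume F < volume (closedBall c r) := by
    rw [← ENNReal.toReal_lt_toReal (ENNReal.mul_ne_top (by simp) hFfin) hQ.volume_ne_top,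
      ENNReal.toReal_mul, ENNReal.toReal_ofNat]
    have h1 : δ * (4 * 2 ^ n) * volume.real (closedBall c r) < 1 * volume.real (closedBall c r) :=
      mul_lt_mul_of_pos_right hδ hVQ
    rw [hvol] at hFvol
    simp only [Measure.real] at *
    linarith
  obtain ⟨u, hu, huB, hcov, hsum⟩ := exists_stopping_balls hr hFsmall
  have hucount : Countable u := hu.to_subtype
  refine ⟨Real.log A, ?_⟩
  let G : (Fin n → ℝ) → ℝ≥0∞ := {x | w x < A / 2}.indicator
    (fun x => ENNReal.ofReal |Real.log (w x) - Real.log A|)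
  let H : (Fin n → ℝ) → ℝ := fun x => 2 / A * (2 * max (A - w x) 0 + (w x - A))
  have hHi : IntegrableOn H P := (((hmaxi.const_mul 2).add (hwi.sub (hc A))).const_mul (2 / A))
  have hH0 (x : Fin n → ℝ) : 0 ≤ H x := by
    have : 0 ≤ 2 * max (A - w x) 0 + (w x - A) := by
      linarith [le_max_left (A - w x) 0, le_max_right (A - w x) 0]
    positivity
  -- The part where `w` is at least half of its mean.
  have hHint : ∫⁻ x in closedBall c r, ENNReal.ofReal (H x) ≤
      ENNReal.ofReal (8 * 10 ^ n * L * δ) * volume (closedBall c r) := by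
    calc ∫⁻ x in closedBall c r, ENNReal.ofReal (H x)
        ≤ ∫⁻ x in P, ENNReal.ofReal (H x) := lintegral_mono_set hQP
      _ = ENNReal.ofReal (∫ x in P, H x) :=
          (ofReal_integral_eq_lintegral_ofReal hHi (ae_of_all _ hH0)).symm
      _ ≤ ENNReal.ofReal (8 * 10 ^ n * L * δ * volume.real (closedBall c r)) := by
          refine ENNReal.ofReal_le_ofReal ?_
          have h1 : ∫ x in P, H x = 2 / A * (2 * ∫ x in P, max (A - w x) 0) := by
            have h2 : ∫ x in P, (2 * max (A - w x) 0 + (w x - A)) =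
                (∫ x in P, 2 * max (A - w x) 0) + ∫ x in P, (w x - A) :=
              integral_add (hmaxi.const_mul 2) (hwi.sub (hc A))
            rw [integral_const_mul, h2, integral_const_mul, integral_sub hwi (hc A), hint,
              setIntegral_const, smul_eq_mul, sub_self, add_zero]
          have h3 : 2 / A * (2 * (δ * (volume.real P * A))) = 4 * δ * volume.real P := by
            field_simp
            ring
          have h4 : (2 : ℝ) ^ n ≤ 10 ^ n := pow_le_pow_left₀ (by norm_num) (by norm_num) n
          calc ∫ x in P, H x ≤ 2 / A * (2 * (δ * (volume.real P * A))) := by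
                rw [h1]
                gcongr
            _ = 4 * 2 ^ n * δ * volume.real (closedBall c r) := by rw [h3, hvol]; ring
            _ ≤ 8 * 10 ^ n * L * δ * volume.real (closedBall c r) := by
                have h5 : 4 * (2 : ℝ) ^ n ≤ 8 * 10 ^ n * L := by
                  nlinarith [pow_pos (by norm_num : (0 : ℝ) < 10) n]
                gcongr
      _ = _ := by
          rw [ENNReal.ofReal_mul (by positivity), Measure.real,
            ENNReal.ofReal_toReal hQ.volume_ne_top]
  -- The part where `w` is less than half of its mean, covered by the stopping balls.
  have hGint : ∫⁻ x in closedBall c r, G x ≤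
      ENNReal.ofReal (20 * 10 ^ n * L * δ) * volume (closedBall c r) := by
    have hae : ∀ᵐ x ∂volume.restrict (closedBall c r),
        G x ≤ (⋃ B : u, closedBall B.1.1 (5 * B.1.2)).indicator G x := by
      have hFnull : NullMeasurableSet F :=
        (nullMeasurableSet_lt hw.isWeight.aemeasurable aemeasurable_const).inter
          hP.measurableSet.nullMeasurableSet
      filter_upwards [ae_restrict_of_ae ((ae_restrict_iff'₀ hFnull).1 hcov),
        ae_restrict_mem hQ.measurableSet] with x hx hxQ
      by_cases hxA : w x < A / 2
      · have := hx ⟨hxA, hQP hxQ⟩ hxQ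
        rw [biUnion_eq_iUnion] at this
        rw [indicator_of_mem this]
      · have : G x = 0 := indicator_of_notMem (s := {x | w x < A / 2}) hxA _
        rw [this]
        exact zero_le
    calc ∫⁻ x in closedBall c r, G x
        ≤ ∫⁻ x, (⋃ B : u, closedBall B.1.1 (5 * B.1.2)).indicator G x :=
          (lintegral_mono_ae hae).trans (setLIntegral_le_lintegral _ _)
      _ = ∫⁻ x in ⋃ B : u, closedBall B.1.1 (5 * B.1.2), G x :=
          lintegral_indicator (MeasurableSet.iUnion fun B => isClosed_closedBall.measurableSet) _
      _ ≤ ∑' B : u, ∫⁻ x in closedBall B.1.1 (5 * B.1.2), G x := lintegral_iUnion_le _ _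
      _ ≤ ∑' B : u, ENNReal.ofReal (5 * L) * volume (closedBall B.1.1 (5 * B.1.2)) := by
          refine ENNReal.tsum_le_tsum fun B => ?_
          obtain ⟨h0, hsub, hhalf⟩ := huB B.1 B.2
          rw [hFdef, inter_assoc, inter_eq_right.2 hsub] at hhalf
          exact hw.lintegral_abs_log_sub_le (isCube_closedBall _ (by positivity)) hA hhalf
      _ ≤ ENNReal.ofReal (5 * L) * (2 * 5 ^ n * volume F) := by
          rw [ENNReal.tsum_mul_left]
          gcongr
      _ = ENNReal.ofReal (5 * L * (2 * 5 ^ n * volume.real F)) := by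
          rw [ENNReal.ofReal_mul (p := 5 * L) (by positivity), ENNReal.ofReal_mul (p := 2 * 5 ^ n)
            (by positivity), ENNReal.ofReal_mul zero_le_two, ENNReal.ofReal_pow (by norm_num),
            Measure.real, ENNReal.ofReal_toReal hFfin]
          simp
      _ ≤ ENNReal.ofReal (20 * 10 ^ n * L * δ * volume.real (closedBall c r)) := by
          refine ENNReal.ofReal_le_ofReal ?_
          rw [hvol] at hFvol
          have h10 : (10 : ℝ) ^ n = 5 ^ n * 2 ^ n := by rw [← mul_pow]; norm_num
          calc 5 * L * (2 * 5 ^ n * volume.real F)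
              ≤ 5 * L * (2 * 5 ^ n * (2 * δ * (2 ^ n * volume.real (closedBall c r)))) := by
                gcongr
            _ = _ := by rw [h10]; ring
      _ = _ := by
          rw [ENNReal.ofReal_mul (by positivity), Measure.real,
            ENNReal.ofReal_toReal hQ.volume_ne_top]
  calc ∫⁻ x in closedBall c r, ENNReal.ofReal |Real.log (w x) - Real.log A|
      ≤ ∫⁻ x in closedBall c r, (ENNReal.ofReal (H x) + G x) := by
        refine lintegral_mono fun x => ?_
        by_cases hxA : w x < A / 2
        · have : G x = ENNReal.ofReal |Real.log (w x) - Real.log A| := 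
            indicator_of_mem (s := {x | w x < A / 2}) hxA _
          rw [this]
          exact le_add_self
        · exact (ENNReal.ofReal_le_ofReal (abs_log_sub_log_le hA (not_lt.1 hxA))).trans le_self_add
    _ = (∫⁻ x in closedBall c r, ENNReal.ofReal (H x)) + ∫⁻ x in closedBall c r, G x :=
        lintegral_add_left' ((hHi.mono_set hQP).aemeasurable.ennreal_ofReal) _
    _ ≤ _ := add_le_add hHint hGint
    _ = _ := by
        rw [← add_mul, ← ENNReal.ofReal_add (by positivity) (by positivity)]
        congr 2
        ring

lemma lintegral_abs_sub_average_le {n : ℕ} {f : (Fin n → ℝ) → ℝ} {Q : Set (Fin n → ℝ)}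
    (hQ : IsCube Q) (hf : IntegrableOn f Q) (a : ℝ) :
    ⨍⁻ x in Q, ‖f x - ⨍ y in Q, f y ∂volume‖ₑ ∂volume ≤
      2 * ((∫⁻ x in Q, ENNReal.ofReal |f x - a|) / volume Q) := by
  have hne : NeZero (volume.restrict Q) := ⟨by simpa using hQ.volume_ne_zero⟩
  have hfin : IsFiniteMeasure (volume.restrict Q) := ⟨by simpa using hQ.volume_ne_top.lt_top⟩
  have hc : IntegrableOn (fun _ : Fin n → ℝ => a) Q := integrableOn_const hQ.volume_ne_top
  have hav : (⨍ y in Q, f y ∂volume) - a = ⨍ y in Q, (f y - a) ∂volume := by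
    have h1 : ⨍ y in Q, (f y - a) ∂volume = (⨍ y in Q, f y ∂volume) - ⨍ _ in Q, a ∂volume := by
      simp only [setAverage_eq, ← smul_sub]
      rw [integral_sub hf hc]
    rw [h1, average_const]
  have hle : ‖a - ⨍ y in Q, f y ∂volume‖ₑ ≤ ⨍⁻ x in Q, ‖f x - a‖ₑ ∂volume := by
    rw [enorm_sub_rev, hav]
    exact enorm_integral_le_lintegral_enorm _
  have henorm (x : Fin n → ℝ) : ENNReal.ofReal |f x - a| = ‖f x - a‖ₑ := by
    rw [← ofReal_norm, Real.norm_eq_abs]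
  simp_rw [henorm]
  rw [← setLAverage_eq]
  calc ⨍⁻ x in Q, ‖f x - ⨍ y in Q, f y ∂volume‖ₑ ∂volume
      ≤ ⨍⁻ x in Q, (‖f x - a‖ₑ + ‖a - ⨍ y in Q, f y ∂volume‖ₑ) ∂volume := by
        refine laverage_mono_ae (ae_of_all _ fun x => ?_)
        have : f x - ⨍ y in Q, f y ∂volume = (f x - a) + (a - ⨍ y in Q, f y ∂volume) := by ring
        dsimp only
        rw [this]
        exact enorm_add_le _ _
    _ = (⨍⁻ x in Q, ‖f x - a‖ₑ ∂volume) + ‖a - ⨍ y in Q, f y ∂volume‖ₑ := by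
        rw [setLAverage_eq, setLAverage_eq, lintegral_add_right' _ aemeasurable_const,
          ENNReal.add_div, lintegral_const, Measure.restrict_apply_univ,
          ENNReal.mul_div_cancel_right hQ.volume_ne_zero hQ.volume_ne_top]
    _ ≤ _ := by
        rw [two_mul]
        gcongr

lemma MemAinfty.bmoSeminorm_log_le {n : ℕ} (hn : 0 < n) {w : (Fin n → ℝ) → ℝ}
    (hw : MemAinfty w) : bmoSeminorm (fun x => Real.log (w x)) ≤
      ENNReal.ofReal (56 * 10 ^ n * Real.log (2 * (hruscevConst w).toReal) *
        ((fujiiWilsonConst w).toReal - 1)) := by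
  refine iSup₂_le fun Q hQ => ?_
  have hδ0 := hw.one_le_fujiiWilsonConst hn
  have hL0 : 0 ≤ Real.log (2 * (hruscevConst w).toReal) :=
    Real.log_nonneg (by linarith [hw.one_le_hruscevConst])
  obtain ⟨a, ha⟩ : ∃ a : ℝ, ∫⁻ x in Q, ENNReal.ofReal |Real.log (w x) - a| ≤
      ENNReal.ofReal (28 * 10 ^ n * Real.log (2 * (hruscevConst w).toReal) *
        ((fujiiWilsonConst w).toReal - 1)) * volume Q := by
    rcases lt_or_ge (((fujiiWilsonConst w).toReal - 1) * (4 * 2 ^ n)) 1 with hδ | hδ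
    · exact hw.lintegral_abs_log_sub_le_of_small hn hδ hQ
    -- For a large excess the bound by the Hruščev constant alone suffices.
    · refine ⟨Real.log (⨍ x in Q, w x ∂volume), ?_⟩
      have hi : IntegrableOn
          (fun x => |Real.log (w x) - Real.log (⨍ x in Q, w x ∂volume)|) Q :=
        ((hw.integrableOn_log hQ).sub (integrableOn_const hQ.volume_ne_top)).abs
      rw [← ofReal_integral_eq_lintegral_ofReal hi (ae_of_all _ fun x => abs_nonneg _)]
      refine (ENNReal.ofReal_le_ofReal (hw.integral_abs_log_sub_le hQ)).trans ?_
      rw [ENNReal.ofReal_mul (by positivity), Measure.real, ENNReal.ofReal_toReal hQ.volume_ne_top]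
      gcongr ENNReal.ofReal ?_ * _
      have h4 : (2 : ℝ) ^ n ≤ 10 ^ n := pow_le_pow_left₀ (by norm_num) (by norm_num) n
      set δ := (fujiiWilsonConst w).toReal - 1
      set L := Real.log (2 * (hruscevConst w).toReal)
      have hδ' : 0 ≤ δ := by linarith
      have h5 : 3 ≤ 28 * 10 ^ n * δ := by nlinarith
      nlinarith
  refine (lintegral_abs_sub_average_le hQ (hw.integrableOn_log hQ) a).trans ?_
  calc 2 * ((∫⁻ x in Q, ENNReal.ofReal |Real.log (w x) - a|) / volume Q)
      ≤ 2 * ENNReal.ofReal (28 * 10 ^ n * Real.log (2 * (hruscevConst w).toReal) *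
        ((fujiiWilsonConst w).toReal - 1)) := by
        gcongr
        exact ENNReal.div_le_of_le_mul ha
    _ = _ := by
        rw [← ENNReal.ofReal_ofNat 2, ← ENNReal.ofReal_mul zero_le_two]
        congr 1
        ring

lemma MemAinfty.locallyIntegrable_log {n : ℕ} {w : (Fin n → ℝ) → ℝ} (hw : MemAinfty w) :
    LocallyIntegrable (fun x => Real.log (w x)) := fun x =>
  ⟨closedBall x 1, closedBall_mem_nhds x one_pos,
    hw.integrableOn_log (isCube_closedBall x one_pos)⟩

end Weights

theorem mainTheorem3 (n : ℕ) (hn : 0 < n) :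
    ∃ c : ℝ, 0 < c ∧ ∀ w : (Fin n → ℝ) → ℝ, Weights.MemAinfty w →
      Weights.fujiiWilsonConst w < ∞ ∧ Weights.hruscevConst w < ∞ ∧
      Weights.MemBMO (fun x => Real.log (w x)) ∧
      (Weights.bmoSeminorm (fun x => Real.log (w x))).toReal ≤
        c * Real.log (2 * (Weights.hruscevConst w).toReal) *
          ((Weights.fujiiWilsonConst w).toReal - 1) := by
  refine ⟨56 * 10 ^ n, by positivity, fun w hw => ?_⟩
  have hbmo := hw.bmoSeminorm_log_le hn
  refine ⟨hw.fujiiWilsonConst_lt_top hn, hw.hruscevConst_lt_top,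
    ⟨hw.locallyIntegrable_log, hbmo.trans_lt ENNReal.ofReal_lt_top⟩, ?_⟩
  refine ENNReal.toReal_le_of_le_ofReal ?_ hbmo
  have hδ0 := hw.one_le_fujiiWilsonConst hn
  have hL0 : 0 ≤ Real.log (2 * (Weights.hruscevConst w).toReal) :=
    Real.log_nonneg (by linarith [hw.one_le_hruscevConst])
  exact mul_nonneg (mul_nonneg (by positivity) hL0) (by linarith)
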